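/- Let $X$ be a compact metric space, $T\colon X\to X$ a continuous map (for instance a homeomorphism), $\mu$ a $T$-invariant Borel probability measure on $X$, and $\Xi$ a subset of $\mathbb S^1=\{z\in\mathbb C:|z|=1\}$. Write $C(X)$ for the continuous functions $f\colon X\to\mathbb C$ with the sup norm, and for $f\in C(X)$, $\xi\in\mathbb S^1$, $x\in X$, $n\ge 1$ put $$\mathrm{Av}_n[f,\bar\xi](x)=\frac1n\sum_{j=0}^{n-1}\xi^{-j}f(T^jx),\qquad \mathrm{Av}[f,\bar\xi](x)=\lim_{n\to\infty}\mathrm{Av}_n[f,\bar\xi](x)$$ whenever the limit exists. Let $U_T f=f\circ T$ be the Koopman operator on $L^2(X,\mu)$, let $\mathrm{Spec}(X,T,\mu)\subseteq\mathbb S^1$ be the set of its eigenvalues, let $\mathcal K\subseteq L^2(X,\mu)$ be the closed linear span of its eigenfunctions, and let $P_{\mathcal K}$ be the orthogonal projection of $L^2(X,\mu)$ onto $\mathcal K$. A point $x\in X$ is *$\mu$-generic* if $\frac1n\sum_{j=0}^{n-1}f(T^jx)\to\int f\,d\mu$ for every $f\in C(X)$. It is *Wiener–Wintner $\mu$-generic*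 if it is $\mu$-generic and $(\mathrm{Av}_n[f,\bar\xi](x))_{n\ge1}$ converges for all $f\in C(X)$ and $\xi\in\mathbb S^1$. Let $\mathrm{Freq}(x)$ be the set of all $\xi\in\mathbb S^1$ such that $\limsup_{n\to\infty}|\mathrm{Av}_n[f,\bar\xi](x)|>0$ for some $f\in C(X)$. A Wiener–Wintner $\mu$-generic point $x$ is *regular* if $\|P_{\mathcal K}f\|_2^2=\sum_{\xi\in\mathrm{Freq}(x)}|\mathrm{Av}[f,\bar\xi](x)|^2$ for every $f\in C(X)$. Then the following conditions are equivalent: 1. $\mu$ is ergodic and $\mathrm{Spec}(X,T,\mu)\subseteq\Xi$. 2. There is a Borel set $X'$ with $\mu(X')=1$ such that every $x\in X'$ is a regular Wiener–Wintner $\mu$-generic point and, for every $f\in C(X)$, $$\|P_{\mathcal K}f\|_2^2=\sum_{\xi\in\Xi}|\mathrm{Av}[f,\bar\xi](x)|^2.\qquad(*)$$ 3. There are a $\mu$-generic point $x\in X$ and a countable dense set $\mathcal D\subseteq C(X)$ such that, for every $f\in\mathcal D$, the sequence $(\mathrm{Av}_n[f,\bar\xi](x))_{n\ge1}$ converges for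 every $\xi\in\Xi$ and $(*)$ holds. 4. There is a regular Wiener–Wintner $\mu$-generic point $x$ with $\mathrm{Freq}(x)\subseteq\Xi$. -/

import Mathlib

open MeasureTheory Filter Topology

noncomputable section

namespace WienerWintner

variable {X : Type*}

/-- The weighted ergodic averages `(1/n) ∑_{j<n} ξ^{-j} f(T^j x)`. -/
def avN (T : X → X) (f : X → ℂ) (ξ : Circle) (n : ℕ) (x : X) : ℂ :=
  (1 / (n : ℂ)) * ∑ j ∈ Finset.range n, (ξ : ℂ) ^ (-(j : ℤ)) * f (T^[j] x)

/-- The averages `avN T f ξ n x` converge as `n → ∞`. -/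
def AvConverges (T : X → X) (f : X → ℂ) (ξ : Circle) (x : X) : Prop :=
  ∃ a : ℂ, Tendsto (fun n => avN T f ξ n x) atTop (𝓝 a)

/-- The limit of the averages; meaningful only under `AvConverges T f ξ x`. -/
def av (T : X → X) (f : X → ℂ) (ξ : Circle) (x : X) : ℂ :=
  limUnder atTop (fun n => avN T f ξ n x)

theorem AvConverges.tendsto {T : X → X} {f : X → ℂ} {ξ : Circle} {x : X}
    (h : AvConverges T f ξ x) :
    Tendsto (fun n => avN T f ξ n x) atTop (𝓝 (av T f ξ x)) :=
  tendsto_nhds_limUnder h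

/-- The set of frequencies of `x`. The averages of a continuous function on a compact space are
bounded, so the real-valued `limsup` is the usual one. -/
def Freq [TopologicalSpace X] (T : X → X) (x : X) : Set Circle :=
  {ξ | ∃ f : C(X, ℂ), 0 < limsup (fun n => ‖avN T f ξ n x‖) atTop}

/-- `x` is a generic point for `μ`. -/
def IsGeneric [TopologicalSpace X] [MeasurableSpace X] (T : X → X) (μ : Measure X) (x : X) :
    Prop :=
  ∀ f : C(X, ℂ), Tendsto (fun n : ℕ => (1 / (n : ℂ)) * ∑ j ∈ Finset.range n, f (T^[j] x)) atTop
    (𝓝 (∫ y, f y ∂μ))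

/-- `x` is a Wiener--Wintner `μ`-generic point. -/
def IsWWGeneric [TopologicalSpace X] [MeasurableSpace X] (T : X → X) (μ : Measure X) (x : X) :
    Prop :=
  IsGeneric T μ x ∧ ∀ (f : C(X, ℂ)) (ξ : Circle), AvConverges T f ξ x

section Koopman

variable [MeasurableSpace X] {T : X → X} {μ : Measure X}

/-- The Koopman operator `f ↦ f ∘ T` on `L²(X, μ)`. -/
def koopman (hμ : MeasurePreserving T μ μ) : Lp ℂ 2 μ →ₗᵢ[ℂ] Lp ℂ 2 μ :=
  Lp.compMeasurePreservingₗᵢ ℂ T hμ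

/-- Every eigenvalue of the Koopman operator lies on the unit circle. -/
theorem norm_eq_one_of_hasEigenvalue (hμ : MeasurePreserving T μ μ) {z : ℂ}
    (hz : Module.End.HasEigenvalue (koopman hμ).toLinearMap z) : ‖z‖ = 1 := by
  obtain ⟨v, hv⟩ := hz.exists_hasEigenvector
  have h1 : koopman hμ v = z • v := hv.apply_eq_smul
  have h2 : ‖z‖ * ‖v‖ = ‖v‖ := by rw [← norm_smul, ← h1, LinearIsometry.norm_map]
  exact mul_right_cancel₀ (norm_ne_zero_iff.mpr hv.2) (by rw [h2, one_mul])

/-- `Spec(X, T, μ)`: the set of eigenvalues of the Koopman operator. -/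
def Spec (hμ : MeasurePreserving T μ μ) : Set Circle :=
  {ξ | Module.End.HasEigenvalue (koopman hμ).toLinearMap (ξ : ℂ)}

/-- The closed linear span in `L²(X, μ)` of the eigenfunctions of the Koopman operator. -/
def kronecker (hμ : MeasurePreserving T μ μ) : Submodule ℂ (Lp ℂ 2 μ) :=
  (Submodule.span ℂ
    {v | ∃ z : ℂ, Module.End.HasEigenvector (koopman hμ).toLinearMap z v}).topologicalClosure

instance (hμ : MeasurePreserving T μ μ) : CompleteSpace (kronecker hμ) :=
  inferInstanceAs (CompleteSpace (Submodule.topologicalClosure _))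

/-- `‖P_𝒦 f‖₂²`, where `P_𝒦` is the orthogonal projection of `L²(X, μ)` onto `kronecker hμ`. -/
def kroneckerNormSq [TopologicalSpace X] [CompactSpace X] [BorelSpace X]
    [SecondCountableTopologyEither X ℂ] [IsFiniteMeasure μ]
    (hμ : MeasurePreserving T μ μ) (f : C(X, ℂ)) : ℝ :=
  ‖(kronecker hμ).starProjection (ContinuousMap.toLp 2 μ ℂ f)‖ ^ 2

/-- `x` is a regular Wiener--Wintner `μ`-generic point. -/
def IsRegularWWGeneric [TopologicalSpace X] [CompactSpace X] [BorelSpace X]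
    [SecondCountableTopologyEither X ℂ] [IsFiniteMeasure μ]
    (hμ : MeasurePreserving T μ μ) (x : X) : Prop :=
  IsWWGeneric T μ x ∧
    ∀ f : C(X, ℂ), HasSum (fun ξ : Freq T x => ‖av T f ξ x‖ ^ 2) (kroneckerNormSq hμ f)

end Koopman

end WienerWintner

end

open scoped ComplexConjugate InnerProductSpace

/-! ### Weighted averages along one orbit -/

namespace WienerWintner

variable {X : Type*}

/-! The heart is a rigidity of generic points (`IsGeneric.exists_eigenvector`). If `x` is generic,
Cauchy–Schwarz bounds `|Av_n[f, ξ̄](x)|²` by the average of `|f|²`, which tends to `‖f‖₂²`. Hence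
any ultrafilter limit of the averages is a functional of `f` that is contractive for the `L²` norm,
so it is `⟪e, f⟫` with `‖e‖ ≤ 1`. Replacing `f` by `f ∘ T` multiplies the averages by `ξ` up to
`O(1/n)`, which forces `U_T e = ξ e`. In particular the averages tend to `0` when `ξ` is not an
eigenvalue.

From 3 to 1: the vectors `e_ξ` are pairwise orthogonal. If `g ∈ 𝒦` is orthogonal to every `e_ξ` with
`ξ ∈ Ξ`, then (*) and Bessel applied to `f - g` give `‖P_𝒦 f‖ ≤ ‖f - g‖` on a dense set; letting `f
→ g` yields `g = 0`. An eigenfunction with eigenvalue outside `Ξ` is such a `g`, and so is `1_A -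
μ(A)` for an invariant set `A`, because genericity gives `e_1 = 1`.

From 1 to 2: under ergodicity the eigenvalues are simple and countably many, with eigenfunctions `v`
of modulus one. Birkhoff's theorem for `f · conj v` gives `Av[f, ξ̄](x) = v(x) ⟪v, f⟫` almost
everywhere; off the spectrum the limits vanish at every generic point. Parseval in `𝒦` is then (*).
Conditions 2, 4 and 3 are linked by comparing sums of nonnegative terms over different index sets.
-/

theorem avN_add (T : X → X) (f g : X → ℂ) (ξ : Circle) (n : ℕ) (x : X) :
    avN T (f + g) ξ n x = avN T f ξ n x + avN T g ξ n x := by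
  simp [avN, mul_add, Finset.sum_add_distrib]

theorem avN_smul (T : X → X) (c : ℂ) (f : X → ℂ) (ξ : Circle) (n : ℕ) (x : X) :
    avN T (c • f) ξ n x = c * avN T f ξ n x := by
  simp only [avN, Pi.smul_apply, smul_eq_mul, Finset.mul_sum]
  exact Finset.sum_congr rfl fun j _ => by ring

theorem avN_one (T : X → X) (f : X → ℂ) (n : ℕ) (x : X) :
    avN T f 1 n x = (1 / (n : ℂ)) * ∑ j ∈ Finset.range n, f (T^[j] x) := by
  simp [avN]

theorem norm_avN_le_average (T : X → X) (f : X → ℂ) (ξ : Circle) (n : ℕ) (x : X) :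
    ‖avN T f ξ n x‖ ≤ (1 / (n : ℝ)) * ∑ j ∈ Finset.range n, ‖f (T^[j] x)‖ := by
  rw [avN, norm_mul]
  refine mul_le_mul (by simp) ((norm_sum_le _ _).trans_eq ?_) (norm_nonneg _) (by positivity)
  exact Finset.sum_congr rfl fun j _ => by
    rw [norm_mul, norm_zpow, Circle.norm_coe, one_zpow, one_mul]

theorem norm_avN_le (T : X → X) {f : X → ℂ} {C : ℝ} (hf : ∀ y, ‖f y‖ ≤ C)
    (ξ : Circle) (n : ℕ) (x : X) : ‖avN T f ξ n x‖ ≤ C := by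
  have hC : 0 ≤ C := (norm_nonneg _).trans (hf x)
  refine (norm_avN_le_average T f ξ n x).trans ?_
  -- For `n = 0` the average is `0`, since `1 / 0 = 0`.
  rcases Nat.eq_zero_or_pos n with rfl | hn
  · simpa using hC
  have : ∑ j ∈ Finset.range n, ‖f (T^[j] x)‖ ≤ n * C := by
    simpa using Finset.sum_le_card_nsmul (Finset.range n) _ C fun j _ => hf (T^[j] x)
  rw [one_div, inv_mul_le_iff₀ (by positivity)]
  exact this

/-- Cauchy–Schwarz. The right side is written as an unweighted average of a continuous function so
that genericity computes its limit. -/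
theorem norm_avN_sq_le (T : X → X) (f : X → ℂ) (ξ : Circle) (n : ℕ) (x : X) :
    ‖avN T f ξ n x‖ ^ 2 ≤ ‖avN T (fun y => f y * conj (f y)) 1 n x‖ := by
  have h1 : ‖avN T (fun y => f y * conj (f y)) 1 n x‖ =
      (1 / (n : ℝ)) * ∑ j ∈ Finset.range n, ‖f (T^[j] x)‖ ^ 2 := by
    have : avN T (fun y => f y * conj (f y)) 1 n x =
        (((1 / (n : ℝ)) * ∑ j ∈ Finset.range n, ‖f (T^[j] x)‖ ^ 2 : ℝ) : ℂ) := by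
      simp [avN_one, Complex.mul_conj']
    rw [this, Complex.norm_real, Real.norm_of_nonneg]
    positivity
  rw [h1]
  refine (pow_le_pow_left₀ (norm_nonneg _) (norm_avN_le_average T f ξ n x) 2).trans ?_
  rcases Nat.eq_zero_or_pos n with rfl | hn
  · simp
  have h2 := sq_sum_le_card_mul_sum_sq (s := Finset.range n) (f := fun j => ‖f (T^[j] x)‖)
  rw [Finset.card_range] at h2
  have hn' : (0 : ℝ) < n := by exact_mod_cast hn
  rw [mul_pow]
  calc (1 / (n : ℝ)) ^ 2 * (∑ j ∈ Finset.range n, ‖f (T^[j] x)‖) ^ 2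
      ≤ (1 / (n : ℝ)) ^ 2 * (n * ∑ j ∈ Finset.range n, ‖f (T^[j] x)‖ ^ 2) := by gcongr
    _ = _ := by field_simp

/-- Shifting the summation index by one costs a factor `ξ` and the two endpoint terms. -/
theorem avN_comp (T : X → X) (f : X → ℂ) (ξ : Circle) (n : ℕ) (x : X) :
    avN T (f ∘ T) ξ n x = ξ * avN T f ξ n x +
      (1 / (n : ℂ)) * (ξ * ((ξ : ℂ) ^ (-(n : ℤ)) * f (T^[n] x) - f x)) := by
  have h : ∑ j ∈ Finset.range n, (ξ : ℂ) ^ (-(j : ℤ)) * f (T (T^[j] x)) =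
      ξ * ∑ j ∈ Finset.range n, (ξ : ℂ) ^ (-((j + 1 : ℕ) : ℤ)) * f (T^[j + 1] x) := by
    rw [Finset.mul_sum]
    refine Finset.sum_congr rfl fun j _ => ?_
    rw [Function.iterate_succ_apply', ← mul_assoc]
    congr 1
    rw [← zpow_one_add₀ (Circle.coe_ne_zero ξ)]
    congr 1
    push_cast
    ring
  have h2 := Finset.sum_range_succ' (fun j : ℕ => (ξ : ℂ) ^ (-(j : ℤ)) * f (T^[j] x)) n
  rw [Finset.sum_range_succ] at h2
  simp only [avN, Function.comp_apply]
  rw [h, ← sub_eq_of_eq_add h2]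
  simp
  ring

theorem tendsto_avN_comp_sub (T : X → X) {f : X → ℂ} {C : ℝ} (hf : ∀ y, ‖f y‖ ≤ C) (ξ : Circle)
    (x : X) : Tendsto (fun n => avN T (f ∘ T) ξ n x - ξ * avN T f ξ n x) atTop (𝓝 0) := by
  have h0 : Tendsto (fun n : ℕ => (1 / (n : ℝ)) * (C + C)) atTop (𝓝 0) := by
    simpa using (tendsto_one_div_atTop_nhds_zero_nat (𝕜 := ℝ)).mul_const (C + C)
  refine squeeze_zero_norm (fun n => ?_) h0
  rw [avN_comp, add_sub_cancel_left, norm_mul, norm_mul]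
  refine mul_le_mul (by simp) ?_ (by positivity) (by positivity)
  rw [Circle.norm_coe, one_mul]
  refine (norm_sub_le _ _).trans (add_le_add ?_ (hf x))
  rw [norm_mul, norm_zpow, Circle.norm_coe, one_zpow, one_mul]
  exact hf _

/-! ### Limits at a generic point as eigenfunctions -/

variable [MeasurableSpace X] {T : X → X} {μ : Measure X}

/-- Eigenvectors of the adjoint of an isometry for a
unimodular eigenvalue are eigenvectors of the isometry. -/
theorem _root_.LinearIsometry.apply_eq_smul_of_inner {H : Type*} [NormedAddCommGroup H]
    [InnerProductSpace ℂ H] (U : H →ₗᵢ[ℂ] H) (ξ : Circle) (e : H)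
    (h : ∀ v, ⟪e, U v⟫_ℂ = ξ * ⟪e, v⟫_ℂ) : U e = (ξ : ℂ) • e := by
  have h0 : ⟪(ξ : ℂ) • e, U e⟫_ℂ = ((‖e‖ ^ 2 : ℝ) : ℂ) := by
    have hξ : conj (ξ : ℂ) * ξ = 1 := by
      rw [mul_comm, Complex.mul_conj, Circle.normSq_coe, Complex.ofReal_one]
    rw [inner_smul_left, h, ← mul_assoc, hξ, one_mul, inner_self_eq_norm_sq_to_K]
    norm_cast
  -- Equality case of Cauchy–Schwarz: both vectors have norm `‖e‖`, and their inner product is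
  -- `‖e‖²`.
  have h1 : ‖U e - (ξ : ℂ) • e‖ ^ 2 = 0 := by
    rw [norm_sub_rev, @norm_sub_sq ℂ, LinearIsometry.norm_map, norm_smul, Circle.norm_coe,
      one_mul, h0, RCLike.re_eq_complex_re, Complex.ofReal_re]
    ring
  rwa [sq_eq_zero_iff, norm_eq_zero, sub_eq_zero] at h1

theorem inner_eq_zero_of_koopman_eq_smul (hμ : MeasurePreserving T μ μ) {ξ η : Circle}
    (hne : ξ ≠ η) {v w : Lp ℂ 2 μ} (hv : koopman hμ v = (ξ : ℂ) • v)
    (hw : koopman hμ w = (η : ℂ) • w) : ⟪v, w⟫_ℂ = 0 := by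
  have h := (koopman hμ).inner_map_map v w
  rw [hv, hw, inner_smul_left, inner_smul_right, ← mul_assoc] at h
  by_contra h0
  refine hne ?_
  have h1 : conj (ξ : ℂ) * η = 1 := mul_right_cancel₀ h0 (by rw [h, one_mul])
  rw [← Circle.coe_inv_eq_conj, ← Circle.coe_mul, Circle.coe_eq_one] at h1
  exact (inv_mul_eq_one.mp h1)

variable [TopologicalSpace X] [CompactSpace X] [BorelSpace X]
  [SecondCountableTopologyEither X ℂ] [IsFiniteMeasure μ]

theorem koopman_toLp (hT : Continuous T) (hμ : MeasurePreserving T μ μ) (f : C(X, ℂ)) :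
    koopman hμ (ContinuousMap.toLp 2 μ ℂ f) =
      ContinuousMap.toLp 2 μ ℂ (f.comp ⟨T, hT⟩) := by
  refine Lp.ext ?_
  have h1 : koopman hμ (ContinuousMap.toLp 2 μ ℂ f) =ᵐ[μ] (ContinuousMap.toLp 2 μ ℂ f) ∘ T :=
    Lp.coeFn_compMeasurePreserving _ hμ
  have h2 := hμ.quasiMeasurePreserving.ae_eq_comp (ContinuousMap.coeFn_toLp (p := 2) (𝕜 := ℂ) μ f)
  have h3 := ContinuousMap.coeFn_toLp (p := 2) (𝕜 := ℂ) μ (f.comp ⟨T, hT⟩)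
  exact h1.trans (h2.trans h3.symm)

theorem norm_toLp_sq (f : C(X, ℂ)) :
    ((‖ContinuousMap.toLp 2 μ ℂ f‖ ^ 2 : ℝ) : ℂ) = ∫ y, f y * conj (f y) ∂μ := by
  rw [← ContinuousMap.inner_toLp, inner_self_eq_norm_sq_to_K]
  norm_cast

theorem IsGeneric.norm_le_of_tendsto {x : X} (hx : IsGeneric T μ x) (ξ : Circle)
    {F : Filter ℕ} [F.NeBot] (hF : F ≤ atTop) {f : C(X, ℂ)} {a : ℂ}
    (ha : Tendsto (fun n => avN T f ξ n x) F (𝓝 a)) :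
    ‖a‖ ≤ ‖ContinuousMap.toLp 2 μ ℂ f‖ := by
  have h1 : Tendsto (fun n => avN T (fun y => f y * conj (f y)) 1 n x) F
      (𝓝 (∫ y, f y * conj (f y) ∂μ)) := by
    simp only [avN_one]
    exact (hx (f * star f)).mono_left hF
  rw [← norm_toLp_sq] at h1
  have h2 := le_of_tendsto_of_tendsto' (ha.norm.pow 2) h1.norm fun n => norm_avN_sq_le T f ξ n x
  rw [Complex.norm_real, Real.norm_of_nonneg (by positivity)] at h2
  exact le_of_sq_le_sq h2 (norm_nonneg _)

/-- Along an ultrafilter, the weighted averages at a generic point are represented by an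
eigenfunction. -/
theorem IsGeneric.exists_eigenvector [NormalSpace X] [μ.WeaklyRegular] (hT : Continuous T)
    (hμ : MeasurePreserving T μ μ)
    {x : X} (hx : IsGeneric T μ x) (ξ : Circle) (𝒰 : Ultrafilter ℕ)
    (h𝒰 : (𝒰 : Filter ℕ) ≤ atTop) :
    ∃ e : Lp ℂ 2 μ, ‖e‖ ≤ 1 ∧ koopman hμ e = (ξ : ℂ) • e ∧ ∀ f : C(X, ℂ),
      Tendsto (fun n => avN T f ξ n x) 𝒰 (𝓝 ⟪e, ContinuousMap.toLp 2 μ ℂ f⟫_ℂ) := by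
  -- The averages stay in the closed disc of radius `‖f‖`, so compactness gives a limit along the
  -- ultrafilter.
  have hlim : ∀ f : C(X, ℂ), ∃ a, Tendsto (fun n => avN T f ξ n x) 𝒰 (𝓝 a) := by
    intro f
    obtain ⟨a, -, ha⟩ := (isCompact_closedBall (0 : ℂ) ‖f‖).ultrafilter_le_nhds'
      (𝒰.map fun n => avN T f ξ n x)
      (Ultrafilter.mem_map.mpr (univ_mem' fun n => by
        simpa using norm_avN_le T f.norm_coe_le_norm ξ n x))
    exact ⟨a, ha⟩
  choose L hL using hlim
  let ℓ : C(X, ℂ) →ₗ[ℂ] ℂ :=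
    { toFun := L
      map_add' := fun f g => tendsto_nhds_unique (hL (f + g)) (by
        simpa only [ContinuousMap.coe_add, avN_add] using (hL f).add (hL g))
      map_smul' := fun c f => tendsto_nhds_unique (hL (c • f)) (by
        simpa only [ContinuousMap.coe_smul, avN_smul, RingHom.id_apply, smul_eq_mul] using
          (hL f).const_mul c) }
  let J : C(X, ℂ) →ₗ[ℂ] Lp ℂ 2 μ := (ContinuousMap.toLp 2 μ ℂ).toLinearMap
  have hJ : DenseRange J := ContinuousMap.toLp_denseRange ℂ μ ℂ (by simp)
  have hb : ∀ f, ‖ℓ f‖ ≤ 1 * ‖J f‖ := fun f => by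
    rw [one_mul]
    exact hx.norm_le_of_tendsto ξ h𝒰 (hL f)
  let e := (InnerProductSpace.toDual ℂ (Lp ℂ 2 μ)).symm (ℓ.extendOfNorm J)
  have he : ∀ f, ⟪e, J f⟫_ℂ = L f := fun f => by
    rw [InnerProductSpace.toDual_symm_apply, LinearMap.extendOfNorm_eq hJ ⟨1, hb⟩]
    rfl
  refine ⟨e, ?_, ?_, fun f => ?_⟩
  · rw [LinearIsometryEquiv.norm_map]
    exact LinearMap.opNorm_extendOfNorm_le hJ zero_le_one hb
  -- The shift relation gives the adjoint eigenvalue equation on the dense image of `C(X)`.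
  · refine LinearIsometry.apply_eq_smul_of_inner _ ξ e fun v => ?_
    refine hJ.induction_on v (isClosed_eq ?_ ?_) fun f => ?_
    · exact continuous_const.inner (koopman hμ).continuous
    · exact continuous_const.mul (continuous_const.inner continuous_id)
    · have h1 : koopman hμ (J f) = J (f.comp ⟨T, hT⟩) := koopman_toLp hT hμ f
      rw [h1, he, he]
      have h2 := (hL (f.comp ⟨T, hT⟩)).sub ((hL f).const_mul (ξ : ℂ))
      have h3 := (tendsto_avN_comp_sub T f.norm_coe_le_norm ξ x).mono_left h𝒰
      exact sub_eq_zero.mp (tendsto_nhds_unique h2 h3)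
  · have := he f
    change ⟪e, ContinuousMap.toLp 2 μ ℂ f⟫_ℂ = L f at this
    rw [this]
    exact hL f

end WienerWintner

/-! ### Bessel's inequality, and ergodicity from a single generic point -/

/-- Bessel's inequality for an orthogonal family in the unit ball. -/
theorem sum_norm_inner_sq_le_of_norm_le_one {ι H : Type*} [NormedAddCommGroup H]
    [InnerProductSpace ℂ H] {e : ι → H} (he : ∀ i, ‖e i‖ ≤ 1)
    (horth : Pairwise fun i j => ⟪e i, e j⟫_ℂ = 0) (v : H) (s : Finset ι) :
    ∑ i ∈ s, ‖⟪e i, v⟫_ℂ‖ ^ 2 ≤ ‖v‖ ^ 2 := by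
  classical
  set w : H := ∑ i ∈ s, ⟪e i, v⟫_ℂ • e i with hw
  set A : ℝ := ∑ i ∈ s, ‖⟪e i, v⟫_ℂ‖ ^ 2 with hA
  have hvw : ⟪w, v⟫_ℂ = (A : ℂ) := by
    rw [hw, sum_inner, hA]
    push_cast
    refine Finset.sum_congr rfl fun i _ => ?_
    rw [inner_smul_left, Complex.conj_mul']
  have hew : ∀ i ∈ s, ⟪e i, w⟫_ℂ = ⟪e i, v⟫_ℂ * (‖e i‖ ^ 2 : ℝ) := by
    intro i hi
    rw [hw, inner_sum, Finset.sum_eq_single_of_mem i hi, inner_smul_right,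
      inner_self_eq_norm_sq_to_K]
    · norm_cast
    · intro j _ hj
      rw [inner_smul_right, horth hj.symm, mul_zero]
  have hww : ‖w‖ ^ 2 = ∑ i ∈ s, ‖⟪e i, v⟫_ℂ‖ ^ 2 * ‖e i‖ ^ 2 := by
    have h : ((‖w‖ ^ 2 : ℝ) : ℂ) = ⟪w, w⟫_ℂ := by
      rw [inner_self_eq_norm_sq_to_K]
      norm_cast
    have h2 : ⟪w, w⟫_ℂ = ((∑ i ∈ s, ‖⟪e i, v⟫_ℂ‖ ^ 2 * ‖e i‖ ^ 2 : ℝ) : ℂ) := by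
      nth_rw 1 [hw]
      rw [sum_inner]
      push_cast
      refine Finset.sum_congr rfl fun i hi => ?_
      rw [inner_smul_left, hew i hi, ← mul_assoc, Complex.conj_mul']
      push_cast
      rfl
    exact_mod_cast h.trans h2
  -- The `e i` need not be unit vectors and may vanish, so only an inequality holds; it suffices, as
  -- `0 ≤ ‖w - v‖² = ‖w‖² - 2A + ‖v‖²`.
  have hwA : ‖w‖ ^ 2 ≤ A := by
    rw [hww, hA]
    refine Finset.sum_le_sum fun i _ => ?_
    exact mul_le_of_le_one_right (by positivity) (pow_le_one₀ (norm_nonneg _) (he i))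
  have h := sq_nonneg ‖w - v‖
  rw [@norm_sub_sq ℂ, hvw, RCLike.re_eq_complex_re, Complex.ofReal_re] at h
  linarith

namespace WienerWintner

section

variable {X : Type*} [MeasurableSpace X] {T : X → X} {μ : Measure X}

theorem mem_kronecker (hμ : MeasurePreserving T μ μ) {z : ℂ} {v : Lp ℂ 2 μ}
    (hv : koopman hμ v = z • v) : v ∈ kronecker hμ := by
  by_cases h0 : v = 0
  · exact h0 ▸ zero_mem _
  · exact Submodule.le_topologicalClosure _
      (Submodule.subset_span ⟨z, Module.End.mem_eigenspace_iff.mpr hv, h0⟩)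

theorem exists_eigenvector_of_mem_Spec (hμ : MeasurePreserving T μ μ) {ξ : Circle}
    (hξ : ξ ∈ Spec hμ) : ∃ v : Lp ℂ 2 μ, v ≠ 0 ∧ koopman hμ v = (ξ : ℂ) • v := by
  obtain ⟨v, hv⟩ := Module.End.HasEigenvalue.exists_hasEigenvector hξ
  exact ⟨v, hv.2, hv.apply_eq_smul⟩

theorem mem_Spec_of_koopman_eq_smul (hμ : MeasurePreserving T μ μ) {ξ : Circle} {v : Lp ℂ 2 μ}
    (h0 : v ≠ 0) (hv : koopman hμ v = (ξ : ℂ) • v) : ξ ∈ Spec hμ :=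
  Module.End.hasEigenvalue_of_hasEigenvector ⟨Module.End.mem_eigenspace_iff.mpr hv, h0⟩

variable [TopologicalSpace X]

theorem av_eq_zero_of_notMem_Freq {x : X} (hx : IsWWGeneric T μ x) {ξ : Circle}
    (hξ : ξ ∉ Freq T x) (f : C(X, ℂ)) : av T f ξ x = 0 := by
  by_contra h
  refine hξ ⟨f, ?_⟩
  rw [(hx.2 f ξ).tendsto.norm.limsup_eq]
  exact norm_pos_iff.mpr h

theorem exists_av_ne_zero_of_mem_Freq {x : X} (hx : IsWWGeneric T μ x) {ξ : Circle}
    (hξ : ξ ∈ Freq T x) : ∃ f : C(X, ℂ), av T f ξ x ≠ 0 := by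
  obtain ⟨f, hf⟩ := hξ
  rw [(hx.2 f ξ).tendsto.norm.limsup_eq] at hf
  exact ⟨f, norm_pos_iff.mp hf⟩

end

variable {X : Type*} [MetricSpace X] [CompactSpace X] [MeasurableSpace X] [BorelSpace X]
  {T : X → X} {μ : Measure X} [IsProbabilityMeasure μ]

theorem koopman_toLp_one (hT : Continuous T) (hμ : MeasurePreserving T μ μ) :
    koopman hμ (ContinuousMap.toLp 2 μ ℂ 1) = ContinuousMap.toLp 2 μ ℂ (1 : C(X, ℂ)) := by
  rw [koopman_toLp hT]
  rfl

theorem norm_toLp_one : ‖ContinuousMap.toLp 2 μ ℂ (1 : C(X, ℂ))‖ = 1 := by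
  have h := norm_toLp_sq (μ := μ) (1 : C(X, ℂ))
  simp only [ContinuousMap.one_apply, one_mul, map_one, integral_const, probReal_univ, one_smul]
    at h
  have h2 : ‖ContinuousMap.toLp 2 μ ℂ (1 : C(X, ℂ))‖ ^ 2 = 1 := by exact_mod_cast h
  exact (pow_eq_one_iff_of_nonneg (norm_nonneg _) two_ne_zero).mp h2

theorem inner_toLp_one (f : C(X, ℂ)) :
    ⟪ContinuousMap.toLp 2 μ ℂ 1, ContinuousMap.toLp 2 μ ℂ f⟫_ℂ = ∫ y, f y ∂μ := by
  rw [ContinuousMap.inner_toLp]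
  simp

theorem ergodic_and_Spec_subset (hT : Continuous T) (hμ : MeasurePreserving T μ μ)
    {Ξ : Set Circle} {x : X} (hx : IsGeneric T μ x) {D : Set C(X, ℂ)} (hD : Dense D)
    (hconv : ∀ f ∈ D, (∀ ξ ∈ Ξ, AvConverges T f ξ x) ∧
      HasSum (fun ξ : Ξ => ‖av T f ξ x‖ ^ 2) (kroneckerNormSq hμ f)) :
    Ergodic T μ ∧ Spec hμ ⊆ Ξ := by
  have h𝒰 : (hyperfilter ℕ : Filter ℕ) ≤ atTop := Nat.hyperfilter_le_atTop
  choose e he1 hek heL using fun ξ : Circle =>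
    hx.exists_eigenvector hT hμ ξ (hyperfilter ℕ) h𝒰
  have hJ : DenseRange (ContinuousMap.toLp 2 μ ℂ : C(X, ℂ) →L[ℂ] Lp ℂ 2 μ) :=
    ContinuousMap.toLp_denseRange ℂ μ ℂ (by simp)
  have hav : ∀ f ∈ D, ∀ ξ ∈ Ξ, av T f ξ x = ⟪e ξ, ContinuousMap.toLp 2 μ ℂ f⟫_ℂ :=
    fun f hf ξ hξ => tendsto_nhds_unique
      (((hconv f hf).1 ξ hξ).tendsto.mono_left h𝒰) (heL ξ f)
  have horth : Pairwise fun ξ η : Ξ => ⟪e ξ, e η⟫_ℂ = 0 := fun ξ η hne =>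
    inner_eq_zero_of_koopman_eq_smul hμ (fun h => hne (Subtype.ext h)) (hek ξ) (hek η)
  -- Subtracting `g` leaves the coefficients in (*) unchanged, so Bessel bounds the projection by
  -- `‖v - g‖`; then take `v = g`.
  have key : ∀ g ∈ kronecker hμ, (∀ ξ ∈ Ξ, ⟪e ξ, g⟫_ℂ = 0) → g = 0 := by
    intro g hg hg0
    have hle : ∀ v : Lp ℂ 2 μ, ‖(kronecker hμ).starProjection v‖ ^ 2 ≤ ‖v - g‖ ^ 2 := by
      refine fun v => (hJ.dense_image (ContinuousMap.toLp 2 μ ℂ).continuous hD).induction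
        ?_ (isClosed_le (by fun_prop) (by fun_prop)) v
      rintro _ ⟨f, hf, rfl⟩
      refine hasSum_le_of_sum_le (hconv f hf).2 fun s => ?_
      have := sum_norm_inner_sq_le_of_norm_le_one (fun ξ : Ξ => he1 ξ) horth
        (ContinuousMap.toLp 2 μ ℂ f - g) s
      refine le_trans (le_of_eq (Finset.sum_congr rfl fun ξ _ => ?_)) this
      rw [hav f hf ξ ξ.2, inner_sub_right, hg0 ξ ξ.2, sub_zero]
    have h := hle g
    rw [Submodule.starProjection_eq_self_iff.mpr hg, sub_self, norm_zero] at h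
    have h2 : ‖g‖ ^ 2 = 0 := le_antisymm (by simpa using h) (by positivity)
    simpa using h2
  have hSpec : Spec hμ ⊆ Ξ := by
    intro ξ hξ
    obtain ⟨v, hv0, hv⟩ := exists_eigenvector_of_mem_Spec hμ hξ
    by_contra hn
    refine hv0 (key v (mem_kronecker hμ hv) fun η hη => ?_)
    exact inner_eq_zero_of_koopman_eq_smul hμ (fun h : η = ξ => hn (h ▸ hη)) (hek η) hv
  refine ⟨⟨hμ, ⟨fun s hs hTs => ?_⟩⟩, hSpec⟩
  set o : Lp ℂ 2 μ := ContinuousMap.toLp 2 μ ℂ (1 : C(X, ℂ)) with ho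
  set v : Lp ℂ 2 μ := indicatorConstLp 2 hs (measure_ne_top μ s) (1 : ℂ) with hv
  have hv1 : koopman hμ v = v := by
    have h := Lp.indicatorConstLp_compMeasurePreserving (p := 2) hs (measure_ne_top μ s) (1 : ℂ) hμ
    simp only [hTs] at h
    exact h
  -- Genericity says that the untwisted averages converge to the integral, which is the pairing with
  -- the constant `1`. This does not require `1 ∈ Ξ`.
  have he_one : e 1 = o := by
    refine ext_inner_right ℂ fun w => ?_
    refine hJ.induction_on w (isClosed_eq (by fun_prop) (by fun_prop)) fun f => ?_
    rw [inner_toLp_one]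
    refine tendsto_nhds_unique (heL 1 f) ?_
    simp only [avN_one]
    exact (hx f).mono_left h𝒰
  set g : Lp ℂ 2 μ := v - ⟪o, v⟫_ℂ • o with hg
  have hg1 : koopman hμ g = ((1 : Circle) : ℂ) • g := by
    rw [hg, map_sub, map_smul, hv1, ho, koopman_toLp_one hT, Circle.coe_one, one_smul]
  have hg0 : g = 0 := by
    refine key g (mem_kronecker hμ hg1) fun ξ _ => ?_
    by_cases hξ : ξ = 1
    · rw [hξ, he_one, hg, inner_sub_right, inner_smul_right, inner_self_eq_norm_sq_to_K,
        ho, norm_toLp_one]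
      simp
    · exact inner_eq_zero_of_koopman_eq_smul hμ hξ (hek ξ) hg1
  have hae : ∀ᵐ y ∂μ, s.indicator (fun _ => (1 : ℂ)) y = ⟪o, v⟫_ℂ := by
    have h1 : v = ⟪o, v⟫_ℂ • o := sub_eq_zero.mp hg0
    have h2 : v =ᵐ[μ] (⟪o, v⟫_ℂ • o : Lp ℂ 2 μ) := by rw [← h1]
    filter_upwards [h2, indicatorConstLp_coeFn (p := 2) (hs := hs) (hμs := measure_ne_top μ s)
      (c := (1 : ℂ)), Lp.coeFn_smul ⟪o, v⟫_ℂ o,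
      ContinuousMap.coeFn_toLp (p := 2) (𝕜 := ℂ) μ (1 : C(X, ℂ))] with y h2 h3 h4 h5
    rw [← h3, ← hv, h2, h4, Pi.smul_apply, ho, h5]
    simp
  rw [eventuallyConst_set]
  by_cases hc : ⟪o, v⟫_ℂ = 1
  · left
    filter_upwards [hae] with y hy
    by_contra hys
    rw [Set.indicator_of_notMem hys, hc] at hy
    exact zero_ne_one hy
  · right
    filter_upwards [hae] with y hy hys
    rw [Set.indicator_of_mem hys] at hy
    exact hc hy.symm

theorem IsRegularWWGeneric.hasSum {hμ : MeasurePreserving T μ μ} {x : X}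
    (hx : IsRegularWWGeneric hμ x) (f : C(X, ℂ)) :
    HasSum (fun ξ : Circle => ‖av T f ξ x‖ ^ 2) (kroneckerNormSq hμ f) := by
  refine (hasSum_subtype_iff_of_support_subset fun ξ h => ?_).mp (hx.2 f)
  by_contra hn
  exact h (by simp [av_eq_zero_of_notMem_Freq hx.1 hn f])

theorem IsRegularWWGeneric.hasSum_of_Freq_subset {hμ : MeasurePreserving T μ μ} {x : X}
    (hx : IsRegularWWGeneric hμ x) {Ξ : Set Circle} (hΞ : Freq T x ⊆ Ξ) (f : C(X, ℂ)) :
    HasSum (fun ξ : Ξ => ‖av T f ξ x‖ ^ 2) (kroneckerNormSq hμ f) := by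
  refine (hasSum_subtype_iff_of_support_subset fun ξ h => ?_).mpr (hx.hasSum f)
  by_contra hn
  exact h (by simp [av_eq_zero_of_notMem_Freq hx.1 (fun h => hn (hΞ h)) f])

/-- The sums over the whole circle and over `Ξ` agree and the terms are nonnegative, so every term
outside `Ξ` vanishes. -/
theorem IsRegularWWGeneric.Freq_subset_of_hasSum {hμ : MeasurePreserving T μ μ} {x : X}
    (hx : IsRegularWWGeneric hμ x) {Ξ : Set Circle}
    (hΞ : ∀ f : C(X, ℂ), HasSum (fun ξ : Ξ => ‖av T f ξ x‖ ^ 2) (kroneckerNormSq hμ f)) :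
    Freq T x ⊆ Ξ := by
  intro ξ hξ
  by_contra hn
  obtain ⟨f, hf⟩ := exists_av_ne_zero_of_mem_Freq hx.1 hξ
  set F : Circle → ℝ := fun η => ‖av T f η x‖ ^ 2 with hF
  have h1 : HasSum (Ξ.indicator F) (kroneckerNormSq hμ f) :=
    hasSum_subtype_iff_indicator.mp (hΞ f)
  have h2 : HasSum (fun η => F η - Ξ.indicator F η) 0 := by
    simpa using HasSum.sub (f := F) (hx.hasSum f) h1
  have h3 : F ξ - Ξ.indicator F ξ ≤ 0 := le_hasSum h2 ξ fun η _ =>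
    sub_nonneg.mpr (Set.indicator_le_self' (fun _ _ => by positivity) η)
  rw [Set.indicator_of_notMem hn, sub_zero] at h3
  exact hf (norm_eq_zero.mp (pow_eq_zero_iff two_ne_zero |>.mp (le_antisymm h3 (by positivity))))

end WienerWintner

/-! ### Birkhoff's pointwise ergodic theorem, through maximal sums -/

section Birkhoff

variable {α : Type*}

/-- The running maximum of the Birkhoff sums of orders `0, …, n`. -/
def birkhoffMax (T : α → α) (f : α → ℝ) : ℕ → α → ℝ
  | 0, _ => 0
  | n + 1, x => max 0 (f x + birkhoffMax T f n (T x))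

theorem birkhoffMax_nonneg (T : α → α) (f : α → ℝ) (n : ℕ) (x : α) :
    0 ≤ birkhoffMax T f n x := by
  cases n with
  | zero => exact le_rfl
  | succ n => exact le_max_left _ _

theorem birkhoffSum_le_birkhoffMax (T : α → α) (f : α → ℝ) (n : ℕ) (x : α) :
    birkhoffSum T f n x ≤ birkhoffMax T f n x := by
  induction n generalizing x with
  | zero => simp [birkhoffMax]
  | succ n ih =>
    rw [birkhoffSum_succ']
    exact le_max_of_le_right (add_le_add_right (ih _) _)

theorem monotone_birkhoffMax (T : α → α) (f : α → ℝ) (x : α) :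
    Monotone fun n => birkhoffMax T f n x := by
  refine monotone_nat_of_le_succ fun n => ?_
  induction n generalizing x with
  | zero => exact birkhoffMax_nonneg T f 1 x
  | succ n ih => exact max_le_max_left _ (add_le_add_right (ih _) _)

/-- This form shows that the difference is bounded by `|f x|`, and that it equals `f x` once the
maximum at `T x` is at least `-f x`. -/
theorem birkhoffMax_succ_sub (T : α → α) (f : α → ℝ) (n : ℕ) (x : α) :
    birkhoffMax T f (n + 1) x - birkhoffMax T f n (T x) =
      max (-birkhoffMax T f n (T x)) (f x) := by
  rw [birkhoffMax, ← max_sub_sub_right]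
  simp

/-- The maxima at `x` (order `n + 1`) and at `T x` (order `n`) differ by at most `|f x|`, so the
divergence set is strictly invariant. -/
theorem tendsto_birkhoffMax_map_iff (T : α → α) (f : α → ℝ) (x : α) :
    Tendsto (fun n => birkhoffMax T f n (T x)) atTop atTop ↔
      Tendsto (fun n => birkhoffMax T f n x) atTop atTop := by
  rw [← tendsto_add_atTop_iff_nat (f := fun n => birkhoffMax T f n x) 1]
  constructor
  · intro h
    exact tendsto_atTop_mono (fun n => le_max_right _ _) (tendsto_atTop_add_const_left _ (f x) h)
  · intro h
    have h2 : Tendsto (fun n => birkhoffMax T f (n + 1) x - max 0 (f x)) atTop atTop :=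
      tendsto_atTop_add_const_right _ (-max 0 (f x)) h
    refine tendsto_atTop_mono (fun n => ?_) h2
    have h3 := birkhoffMax_succ_sub T f n x
    have h4 := birkhoffMax_nonneg T f n (T x)
    have h5 : max (-birkhoffMax T f n (T x)) (f x) ≤ max 0 (f x) :=
      max_le_max_right _ (by linarith)
    linarith

variable [MeasurableSpace α] {T : α → α} {μ : Measure α}

theorem measurable_birkhoffMax (hT : Measurable T) {f : α → ℝ} (hf : Measurable f) (n : ℕ) :
    Measurable (birkhoffMax T f n) := by
  induction n with
  | zero => exact measurable_const
  | succ n ih => exact measurable_const.max (hf.add (ih.comp hT))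

theorem integrable_birkhoffMax [IsFiniteMeasure μ] (hT : MeasurePreserving T μ μ) {f : α → ℝ}
    (hf : Integrable f μ) (n : ℕ) : Integrable (birkhoffMax T f n) μ := by
  induction n with
  | zero => exact integrable_const 0
  | succ n ih => exact (integrable_const 0).sup (hf.add (hT.integrable_comp_of_integrable ih))

/-- The Birkhoff sums of a function with negative mean are almost everywhere bounded above. -/
theorem Ergodic.ae_exists_birkhoffSum_le [IsFiniteMeasure μ] (hT : Ergodic T μ) {f : α → ℝ}
    (hfm : Measurable f) (hf : Integrable f μ) (hneg : ∫ x, f x ∂μ < 0) :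
    ∀ᵐ x ∂μ, ∃ C, ∀ n, birkhoffSum T f n x ≤ C := by
  set E : Set α := {x | Tendsto (fun n => birkhoffMax T f n x) atTop atTop} with hE
  have hEm : MeasurableSet E := by
    have : E = ⋂ k : ℕ, ⋃ n : ℕ, {x | (k : ℝ) ≤ birkhoffMax T f n x} := by
      ext x
      simp only [hE, Set.mem_ofPred_eq, Set.mem_iInter, Set.mem_iUnion]
      rw [tendsto_atTop_atTop_iff_of_monotone (monotone_birkhoffMax T f x)]
      refine ⟨fun h k => h k, fun h b => ?_⟩
      obtain ⟨k, hk⟩ := exists_nat_ge b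
      obtain ⟨n, hn⟩ := h k
      exact ⟨n, hk.trans hn⟩
    rw [this]
    exact MeasurableSet.iInter fun k => MeasurableSet.iUnion fun n =>
      measurableSet_le measurable_const (measurable_birkhoffMax hT.measurable hfm n)
  have hEinv : T ⁻¹' E = E := Set.ext fun x => tendsto_birkhoffMax_map_iff T f x
  rcases hT.toPreErgodic.ae_mem_or_ae_notMem hEm hEinv with h | h
  -- If the maxima `M n` diverge almost everywhere, then `M (n+1) - M n ∘ T → f` with dominant
  -- `|f|`. By invariance and monotonicity each integral is nonnegative, hence so is `∫ f`.
  · refine absurd ?_ (not_le.mpr hneg)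
    have hlim : Tendsto (fun n => ∫ x, max (-birkhoffMax T f n (T x)) (f x) ∂μ) atTop
        (𝓝 (∫ x, f x ∂μ)) := by
      refine tendsto_integral_of_dominated_convergence (fun x => ‖f x‖) (fun n => ?_) hf.norm
        (fun n => ?_) ?_
      · exact (((measurable_birkhoffMax hT.measurable hfm n).comp hT.measurable).neg.max
          hfm).aestronglyMeasurable
      · refine ae_of_all _ fun x => ?_
        have h1 := birkhoffMax_nonneg T f n (T x)
        rw [Real.norm_eq_abs, Real.norm_eq_abs, abs_le]
        exact ⟨(neg_abs_le _).trans (le_max_right _ _),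
          max_le (by linarith [abs_nonneg (f x)]) (le_abs_self _)⟩
      · filter_upwards [h] with x hx
        have hx' := (tendsto_birkhoffMax_map_iff T f x).mpr hx
        refine tendsto_const_nhds.congr' ?_
        filter_upwards [hx'.eventually_ge_atTop (-f x)] with n hn
        rw [max_eq_right (by linarith)]
    refine ge_of_tendsto' hlim fun n => ?_
    have hi := integrable_birkhoffMax hT.toMeasurePreserving hf
    have hc : ∫ x, birkhoffMax T f n (T x) ∂μ = ∫ x, birkhoffMax T f n x ∂μ := by
      have hm : AEStronglyMeasurable (birkhoffMax T f n) (μ.map T) := by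
        rw [hT.map_eq]
        exact (hi n).aestronglyMeasurable
      rw [← integral_map hT.measurable.aemeasurable hm, hT.map_eq]
    simp_rw [← birkhoffMax_succ_sub]
    have hs := integral_sub (hi (n + 1))
      (hT.toMeasurePreserving.integrable_comp_of_integrable (hi n))
    simp only [Function.comp_apply] at hs
    rw [hs, hc, sub_nonneg]
    exact integral_mono (hi n) (hi _) fun x => monotone_birkhoffMax T f x n.le_succ
  · filter_upwards [h] with x hx
    have h1 : ¬ ∀ b, ∃ n, b ≤ birkhoffMax T f n x := by
      rwa [← tendsto_atTop_atTop_iff_of_monotone (monotone_birkhoffMax T f x)]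
    push Not at h1
    obtain ⟨C, hC⟩ := h1
    exact ⟨C, fun n => (birkhoffSum_le_birkhoffMax T f n x).trans (hC n).le⟩

theorem Ergodic.ae_eventually_birkhoffAverage_lt [IsProbabilityMeasure μ] (hT : Ergodic T μ)
    {f : α → ℝ} (hfm : Measurable f) (hf : Integrable f μ) :
    ∀ᵐ x ∂μ, ∀ b > ∫ y, f y ∂μ, ∀ᶠ n in atTop, birkhoffAverage ℝ T f n x < b := by
  -- For `q` above the mean, `f - q` has negative mean, so its sums are bounded above. Rational `q`
  -- keep the exceptional set null.
  have h : ∀ q : ℚ, ∫ y, f y ∂μ < q → ∀ᵐ x ∂μ, ∃ C, ∀ n,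
      birkhoffSum T (fun y => f y - q) n x ≤ C := fun q hq =>
    hT.ae_exists_birkhoffSum_le (hfm.sub_const _) (hf.sub (integrable_const _)) (by
      rw [integral_sub hf (integrable_const _)]
      simpa using hq)
  filter_upwards [ae_all_iff.mpr fun q => ae_all_iff.mpr (h q)] with x hx b hb
  obtain ⟨q, hq1, hq2⟩ := exists_rat_btwn hb
  obtain ⟨C, hC⟩ := hx q hq1
  have hlim : Tendsto (fun n : ℕ => (q : ℝ) + C / n) atTop (𝓝 q) := by
    simpa using (tendsto_const_div_atTop_nhds_zero_nat C).const_add (q : ℝ)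
  filter_upwards [hlim.eventually_lt_const hq2, eventually_gt_atTop 0] with n hn hn0
  refine lt_of_le_of_lt ?_ hn
  have h1 : birkhoffSum T f n x - n * q ≤ C := by
    simpa [birkhoffSum, Finset.sum_sub_distrib] using hC n
  have hn' : (0 : ℝ) < n := by exact_mod_cast hn0
  rw [birkhoffAverage, smul_eq_mul, inv_mul_le_iff₀ hn', mul_add, mul_div_cancel₀ _ hn'.ne']
  linarith

/-- Birkhoff's pointwise ergodic theorem for real functions and ergodic maps. -/
theorem Ergodic.ae_tendsto_birkhoffAverage_real [IsProbabilityMeasure μ] (hT : Ergodic T μ)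
    {f : α → ℝ} (hf : Integrable f μ) :
    ∀ᵐ x ∂μ, Tendsto (fun n => birkhoffAverage ℝ T f n x) atTop (𝓝 (∫ y, f y ∂μ)) := by
  set g := hf.1.mk f with hg
  have hfg : f =ᵐ[μ] g := hf.1.ae_eq_mk
  have hgm : Measurable g := hf.1.stronglyMeasurable_mk.measurable
  have hgi : Integrable g μ := hf.congr hfg
  have heq : ∀ᵐ x ∂μ, ∀ n, birkhoffAverage ℝ T f n x = birkhoffAverage ℝ T g n x :=
    ae_all_iff.mpr fun n => hT.quasiMeasurePreserving.birkhoffAverage_ae_eq_of_ae_eq ℝ hfg n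
  filter_upwards [heq, hT.ae_eventually_birkhoffAverage_lt hgm hgi,
    hT.ae_eventually_birkhoffAverage_lt hgm.neg hgi.neg] with x hx h1 h2
  simp only [hx, integral_congr_ae hfg]
  refine tendsto_order.mpr ⟨fun a ha => ?_, h1⟩
  have h3 := h2 (-a) (by simpa only [Pi.neg_apply, integral_neg, gt_iff_lt, neg_lt_neg_iff])
  filter_upwards [h3] with n hn
  rw [birkhoffAverage_neg, Pi.neg_apply, Pi.neg_apply] at hn
  linarith

/-- Birkhoff's pointwise ergodic theorem for complex functions and ergodic maps. -/
theorem Ergodic.ae_tendsto_average [IsProbabilityMeasure μ] (hT : Ergodic T μ)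
    {f : α → ℂ} (hf : Integrable f μ) :
    ∀ᵐ x ∂μ, Tendsto (fun n : ℕ => (1 / (n : ℂ)) * ∑ j ∈ Finset.range n, f (T^[j] x)) atTop
      (𝓝 (∫ y, f y ∂μ)) := by
  filter_upwards [hT.ae_tendsto_birkhoffAverage_real hf.re,
    hT.ae_tendsto_birkhoffAverage_real hf.im] with x h1 h2
  have h3 := ((Complex.continuous_ofReal.tendsto _).comp h1).add
    (((Complex.continuous_ofReal.tendsto _).comp h2).mul_const Complex.I)
  have h4 := integral_re_add_im hf
  simp only [RCLike.re_eq_complex_re, RCLike.im_eq_complex_im, Complex.coe_algebraMap] at h3 h4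
  erw [h4] at h3
  refine h3.congr fun n => ?_
  simp only [Function.comp_apply, birkhoffAverage, birkhoffSum, smul_eq_mul]
  push_cast
  rw [mul_assoc, ← mul_add, Finset.sum_mul, ← Finset.sum_add_distrib, one_div]
  simp only [Complex.re_add_im]

end Birkhoff

/-! ### Parseval's identity and the almost everywhere Wiener–Wintner theorem -/

/-- Parseval's identity for an orthonormal family that is total in a closed subspace. -/
theorem Orthonormal.hasSum_norm_inner_sq_starProjection {ι H : Type*} [NormedAddCommGroup H]
    [InnerProductSpace ℂ H] {K : Submodule ℂ H} [CompleteSpace K] {v : ι → H}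
    (hv : Orthonormal ℂ v) (hvK : ∀ i, v i ∈ K)
    (htot : ∀ x ∈ K, (∀ i, ⟪v i, x⟫_ℂ = 0) → x = 0) (u : H) :
    HasSum (fun i => ‖⟪v i, u⟫_ℂ‖ ^ 2) (‖K.starProjection u‖ ^ 2) := by
  have hbot : (Submodule.span ℂ (Set.range fun i => (⟨v i, hvK i⟩ : K)))ᗮ = ⊥ := by
    refine (Submodule.eq_bot_iff _).mpr fun x hx => ?_
    refine Subtype.ext (htot x x.2 fun i => ?_)
    exact (Submodule.mem_orthogonal _ _).mp hx _ (Submodule.subset_span ⟨i, rfl⟩)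
  let b := HilbertBasis.mkOfOrthogonalEqBot (hv.codRestrict K hvK) hbot
  have hb : ∀ i, ⟪b i, K.orthogonalProjectionOnto u⟫_ℂ = ⟪v i, u⟫_ℂ := fun i => by
    have hbi : b i = ⟨v i, hvK i⟩ :=
      congrFun (HilbertBasis.coe_mkOfOrthogonalEqBot (hv.codRestrict K hvK) hbot) i
    rw [hbi, Submodule.inner_orthogonalProjectionOnto_eq_of_mem_left]
  have h := b.hasSum_inner_mul_inner (K.orthogonalProjectionOnto u)
    (K.orthogonalProjectionOnto u)
  have h2 := Complex.hasSum_re h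
  rw [inner_self_eq_norm_sq_to_K] at h2
  convert! h2 using 1
  · funext i
    rw [← inner_conj_symm (K.orthogonalProjectionOnto u), hb, Complex.conj_mul']
    norm_cast
  · rw [Submodule.starProjection_apply, Submodule.coe_norm]
    norm_cast

namespace WienerWintner

/-- Convergence of weighted averages passes from a dense set of continuous functions to all. -/
theorem tendsto_avN_of_dense {X : Type*} [TopologicalSpace X] [CompactSpace X] {T : X → X}
    {L : C(X, ℂ) → ℂ} (hL : Continuous L) {D : Set C(X, ℂ)}
    (hD : Dense D) {ξ : Circle} {x : X}
    (h : ∀ f ∈ D, Tendsto (fun n => avN T f ξ n x) atTop (𝓝 (L f))) (f : C(X, ℂ)) :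
    Tendsto (fun n => avN T f ξ n x) atTop (𝓝 (L f)) := by
  refine Metric.tendsto_nhds.mpr fun ε hε => ?_
  obtain ⟨g, hg, hgf, hgL⟩ := hD.inter_nhds_nonempty (inter_mem
    (Metric.ball_mem_nhds f (by positivity : 0 < ε / 3))
    (hL.continuousAt (Metric.ball_mem_nhds (L f) (by positivity : 0 < ε / 3))))
  filter_upwards [Metric.tendsto_nhds.mp (h g hg) (ε / 3) (by positivity)] with n hn
  have h1 : dist (avN T f ξ n x) (avN T g ξ n x) < ε / 3 := by
    have h2 : avN T f ξ n x - avN T g ξ n x = avN T (f - g) ξ n x := by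
      rw [sub_eq_iff_eq_add, ← avN_add, sub_add_cancel]
    rw [dist_eq_norm, h2]
    refine lt_of_le_of_lt (norm_avN_le T (C := ‖f - g‖) (f - g).norm_coe_le_norm ξ n x) ?_
    rw [← dist_eq_norm, dist_comm]
    exact hgf
  have h3 : dist (L g) (L f) < ε / 3 := hgL
  linarith [dist_triangle4 (avN T f ξ n x) (avN T g ξ n x) (L g) (L f)]

section Eigenfunctions

variable {X : Type*} [MeasurableSpace X] {T : X → X} {μ : Measure X}

theorem ae_apply_map_of_koopman_eq_smul (hμ : MeasurePreserving T μ μ) {ξ : Circle}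
    {v : Lp ℂ 2 μ} (hv : koopman hμ v = (ξ : ℂ) • v) : ∀ᵐ y ∂μ, v (T y) = ξ * v y := by
  have h1 : koopman hμ v =ᵐ[μ] v ∘ T := Lp.coeFn_compMeasurePreserving _ hμ
  filter_upwards [h1, hv ▸ Lp.coeFn_smul (ξ : ℂ) v] with y h1 h2
  rw [← Function.comp_apply (f := v), ← h1, h2, Pi.smul_apply, smul_eq_mul]

theorem ae_apply_iterate_of_koopman_eq_smul (hμ : MeasurePreserving T μ μ) {ξ : Circle}
    {v : Lp ℂ 2 μ} (hv : koopman hμ v = (ξ : ℂ) • v) :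
    ∀ᵐ y ∂μ, ∀ j : ℕ, v (T^[j] y) = (ξ : ℂ) ^ j * v y := by
  have h := ae_apply_map_of_koopman_eq_smul hμ hv
  filter_upwards [ae_all_iff.mpr fun j => (hμ.iterate j).quasiMeasurePreserving.ae h] with y hy j
  induction j with
  | zero => simp
  | succ j ih => rw [Function.iterate_succ_apply', hy j, ih, pow_succ']; ring

variable [IsProbabilityMeasure μ]

theorem ae_norm_eq_one_of_koopman_eq_smul (hT : Ergodic T μ) (hμ : MeasurePreserving T μ μ)
    {ξ : Circle} {v : Lp ℂ 2 μ} (hv : koopman hμ v = (ξ : ℂ) • v) (hv1 : ‖v‖ = 1) :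
    ∀ᵐ y ∂μ, ‖v y‖ = 1 := by
  obtain ⟨c, hc⟩ := hT.ae_eq_const_of_ae_eq_comp_ae (g := fun y => ‖v y‖)
    (Lp.aestronglyMeasurable v).norm (by
      filter_upwards [ae_apply_map_of_koopman_eq_smul hμ hv] with y hy
      rw [Function.comp_apply, hy, norm_mul, Circle.norm_coe, one_mul])
  have h1 : ((1 : ℝ) : ℂ) = ((c ^ 2 : ℝ) : ℂ) := by
    have h2 : ⟪v, v⟫_ℂ = ∫ y, ((c ^ 2 : ℝ) : ℂ) ∂μ := by
      rw [L2.inner_def]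
      refine integral_congr_ae ?_
      filter_upwards [hc] with y hy
      rw [inner_self_eq_norm_sq_to_K, hy]
      simp
    rw [inner_self_eq_norm_sq_to_K, hv1, integral_const, probReal_univ, one_smul] at h2
    rw [← h2]
    simp
  have h3 : c ^ 2 = 1 := by exact_mod_cast h1.symm
  filter_upwards [hc] with y hy
  have h0 : 0 ≤ c := by
    rw [← Function.const_apply (α := X) (y := c) (x := y), ← hy]
    exact norm_nonneg _
  rw [hy]
  exact (pow_eq_one_iff_of_nonneg h0 two_ne_zero).mp h3

/-- The eigenspaces of an ergodic transformation are at most one-dimensional. -/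
theorem eq_inner_smul_of_koopman_eq_smul (hT : Ergodic T μ) (hμ : MeasurePreserving T μ μ)
    {ξ : Circle} {v w : Lp ℂ 2 μ} (hv : koopman hμ v = (ξ : ℂ) • v) (hv1 : ‖v‖ = 1)
    (hw : koopman hμ w = (ξ : ℂ) • w) : w = ⟪v, w⟫_ℂ • v := by
  -- The quotient of two eigenfunctions is invariant, hence constant; since `|v| = 1`, `conj v`
  -- serves as the inverse of `v`.
  obtain ⟨c, hc⟩ := hT.ae_eq_const_of_ae_eq_comp_ae (g := fun y => conj (v y) * w y)
    ((Complex.continuous_conj.comp_aestronglyMeasurable (Lp.aestronglyMeasurable v)).mul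
      (Lp.aestronglyMeasurable w)) (by
      filter_upwards [ae_apply_map_of_koopman_eq_smul hμ hv,
        ae_apply_map_of_koopman_eq_smul hμ hw] with y h1 h2
      have h3 : conj (ξ : ℂ) * ξ = 1 := by
        rw [mul_comm, Complex.mul_conj, Circle.normSq_coe, Complex.ofReal_one]
      rw [Function.comp_apply, h1, h2, map_mul]
      linear_combination conj (v y) * w y * h3)
  have hwc : w = c • v := by
    refine Lp.ext ?_
    filter_upwards [hc, ae_norm_eq_one_of_koopman_eq_smul hT hμ hv hv1,
      Lp.coeFn_smul c v] with y h1 h2 h3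
    have h4 : v y * conj (v y) = 1 := by rw [Complex.mul_conj', h2]; simp
    rw [h3, Pi.smul_apply, smul_eq_mul, ← Function.const_apply (α := X) (y := c) (x := y), ← h1]
    linear_combination -w y * h4
  rw [hwc, inner_smul_right, inner_self_eq_norm_sq_to_K, hv1]
  simp

end Eigenfunctions

variable {X : Type*} [MetricSpace X] [CompactSpace X] [MeasurableSpace X] [BorelSpace X]
  {T : X → X} {μ : Measure X} [IsProbabilityMeasure μ]

theorem ae_isGeneric (hT : Ergodic T μ) : ∀ᵐ x ∂μ, IsGeneric T μ x := by
  obtain ⟨D, hDc, hD⟩ := TopologicalSpace.exists_countable_dense C(X, ℂ)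
  have hi : ∀ f : C(X, ℂ), Integrable f μ := fun f => f.continuous.integrable_of_hasCompactSupport
    (HasCompactSupport.of_compactSpace _)
  filter_upwards [(ae_ball_iff hDc).mpr fun f _ => hT.ae_tendsto_average (hi f)] with x hx f
  have h := tendsto_avN_of_dense (T := T) (ξ := 1) (x := x)
    (L := fun f : C(X, ℂ) => ∫ y, f y ∂μ) (by
      simp only [← inner_toLp_one]
      fun_prop) hD (fun g hg => by simpa only [avN_one] using hx g hg) f
  simpa only [avN_one] using h

/-- Almost everywhere, the averages twisted by an eigenvalue are given by an eigenfunction. -/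
theorem ae_tendsto_avN_of_koopman_eq_smul (hT : Ergodic T μ) (hμ : MeasurePreserving T μ μ)
    {ξ : Circle} {v : Lp ℂ 2 μ} (hv : koopman hμ v = (ξ : ℂ) • v) (hv1 : ‖v‖ = 1) :
    ∀ᵐ x ∂μ, ‖v x‖ = 1 ∧ ∀ f : C(X, ℂ), Tendsto (fun n => avN T f ξ n x) atTop
      (𝓝 (v x * ⟪v, ContinuousMap.toLp 2 μ ℂ f⟫_ℂ)) := by
  obtain ⟨D, hDc, hD⟩ := TopologicalSpace.exists_countable_dense C(X, ℂ)
  have hae : ∀ f : C(X, ℂ), (fun y => ⟪v y, ContinuousMap.toLp 2 μ ℂ f y⟫_ℂ) =ᵐ[μ]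
      fun y => f y * conj (v y) := fun f => by
    filter_upwards [ContinuousMap.coeFn_toLp (p := 2) (𝕜 := ℂ) μ f] with y hy
    rw [hy]
    simp
  have hi : ∀ f : C(X, ℂ), Integrable (fun y => f y * conj (v y)) μ := fun f =>
    (L2.integrable_inner v (ContinuousMap.toLp 2 μ ℂ f)).congr (hae f)
  filter_upwards [ae_norm_eq_one_of_koopman_eq_smul hT hμ hv hv1,
    ae_apply_iterate_of_koopman_eq_smul hμ hv,
    (ae_ball_iff hDc).mpr fun f _ => hT.ae_tendsto_average (hi f)] with x h1 h2 h3
  refine ⟨h1, tendsto_avN_of_dense (by fun_prop) hD fun f hf => ?_⟩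
  -- Multiplying by `v x` turns `conj (v (T^[j] x))` into the weight `ξ^{-j}`, because `|v x| = 1`.
  have h4 := (h3 f hf).const_mul (v x)
  rw [← integral_congr_ae (hae f), ← L2.inner_def] at h4
  refine h4.congr fun n => ?_
  have h5 : v x * conj (v x) = 1 := by rw [Complex.mul_conj', h1]; simp
  rw [avN, mul_left_comm, Finset.mul_sum]
  congr 1
  refine Finset.sum_congr rfl fun j _ => ?_
  rw [h2 j, map_mul, map_pow, ← Circle.coe_inv_eq_conj, Circle.coe_inv, inv_pow, zpow_neg,
    zpow_natCast]
  linear_combination ((ξ : ℂ) ^ j)⁻¹ * f (T^[j] x) * h5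

theorem IsGeneric.tendsto_avN_of_notMem_Spec (hT : Continuous T) (hμ : MeasurePreserving T μ μ)
    {x : X} (hx : IsGeneric T μ x) {ξ : Circle} (hξ : ξ ∉ Spec hμ) (f : C(X, ℂ)) :
    Tendsto (fun n => avN T f ξ n x) atTop (𝓝 0) := by
  refine (tendsto_iff_ultrafilter _ _ _).mpr fun 𝒰 h𝒰 => ?_
  obtain ⟨e, -, he, hlim⟩ := hx.exists_eigenvector hT hμ ξ 𝒰 h𝒰
  have h0 : e = 0 := by
    by_contra h0
    exact hξ (mem_Spec_of_koopman_eq_smul hμ h0 he)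
  simpa [h0] using hlim f

theorem exists_orthonormal_eigenvectors (hT : Ergodic T μ) (hμ : MeasurePreserving T μ μ) :
    ∃ v : Spec hμ → Lp ℂ 2 μ, (∀ ξ, ‖v ξ‖ = 1) ∧
      (∀ ξ : Spec hμ, koopman hμ (v ξ) = ((ξ : Circle) : ℂ) • v ξ) ∧
      ∀ f : C(X, ℂ), HasSum (fun ξ => ‖⟪v ξ, ContinuousMap.toLp 2 μ ℂ f⟫_ℂ‖ ^ 2)
        (kroneckerNormSq hμ f) := by
  have hex : ∀ ξ : Spec hμ, ∃ v : Lp ℂ 2 μ, ‖v‖ = 1 ∧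
      koopman hμ v = ((ξ : Circle) : ℂ) • v := fun ξ => by
    obtain ⟨v, hv0, hv⟩ := exists_eigenvector_of_mem_Spec hμ ξ.2
    refine ⟨((‖v‖ : ℂ)⁻¹) • v, norm_smul_inv_norm hv0, ?_⟩
    rw [map_smul, hv, smul_comm]
  choose v hv1 hv using hex
  refine ⟨v, hv1, hv, fun f => ?_⟩
  refine Orthonormal.hasSum_norm_inner_sq_starProjection ⟨hv1, fun ξ η hne => ?_⟩
    (fun ξ => mem_kronecker hμ (hv ξ)) (fun x hx h0 => ?_) _
  · exact inner_eq_zero_of_koopman_eq_smul hμ (fun h => hne (Subtype.ext h)) (hv ξ) (hv η)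
  -- By simplicity every eigenvector is a multiple of some `v ξ`, so `x` is orthogonal to all of
  -- `𝒦`, including itself.
  · have hle : kronecker hμ ≤ (ℂ ∙ x)ᗮ := by
      refine Submodule.topologicalClosure_minimal _ (Submodule.span_le.mpr ?_)
        (Submodule.isClosed_orthogonal _)
      rintro w ⟨z, hw⟩
      have hz := norm_eq_one_of_hasEigenvalue hμ (Module.End.hasEigenvalue_of_hasEigenvector hw)
      let ξ : Circle := ⟨z, mem_sphere_zero_iff_norm.mpr hz⟩
      have hwξ : koopman hμ w = (ξ : ℂ) • w := hw.apply_eq_smul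
      have hξ : ξ ∈ Spec hμ := mem_Spec_of_koopman_eq_smul hμ hw.2 hwξ
      have h1 := eq_inner_smul_of_koopman_eq_smul hT hμ (hv ⟨ξ, hξ⟩) (hv1 _) hwξ
      refine Submodule.mem_orthogonal_singleton_iff_inner_left.mpr ?_
      rw [h1, inner_smul_left, h0, mul_zero]
    exact inner_self_eq_zero.mp (Submodule.mem_orthogonal_singleton_iff_inner_left.mp (hle hx))

/-- A summable family has countable support, and each unit eigenvector pairs nontrivially with some
member of a countable dense set. Countability allows one null set for all eigenvalues. -/
theorem countable_Spec (hT : Ergodic T μ) (hμ : MeasurePreserving T μ μ) :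
    Countable (Spec hμ) := by
  obtain ⟨v, hv1, -, hv⟩ := exists_orthonormal_eigenvectors hT hμ
  obtain ⟨D, hDc, hD⟩ := TopologicalSpace.exists_countable_dense C(X, ℂ)
  have hJ : DenseRange (ContinuousMap.toLp 2 μ ℂ : C(X, ℂ) →L[ℂ] Lp ℂ 2 μ) :=
    ContinuousMap.toLp_denseRange ℂ μ ℂ (by simp)
  rw [← Set.countable_univ_iff]
  refine (hDc.biUnion fun f _ => (hv f).summable.countable_support).mono fun ξ _ => ?_
  simp only [Set.mem_iUnion, Function.mem_support]
  by_contra! h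
  have h0 : v ξ = 0 := by
    refine ext_inner_right ℂ fun w => ?_
    rw [inner_zero_left]
    refine (hJ.dense_image (ContinuousMap.toLp 2 μ ℂ).continuous hD).induction
      ?_ (isClosed_eq (by fun_prop) continuous_const) w
    rintro _ ⟨f, hf, rfl⟩
    simpa using h f hf
  simpa [h0] using hv1 ξ

/-- The Wiener--Wintner theorem, with the Parseval identity for the limits. -/
theorem ae_isRegularWWGeneric (hc : Continuous T) (hT : Ergodic T μ)
    (hμ : MeasurePreserving T μ μ) {Ξ : Set Circle} (hΞ : Spec hμ ⊆ Ξ) :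
    ∀ᵐ x ∂μ, IsRegularWWGeneric hμ x ∧
      ∀ f : C(X, ℂ), HasSum (fun ξ : Ξ => ‖av T f ξ x‖ ^ 2) (kroneckerNormSq hμ f) := by
  obtain ⟨v, hv1, hv, hsum⟩ := exists_orthonormal_eigenvectors hT hμ
  have := countable_Spec hT hμ
  filter_upwards [ae_isGeneric hT, ae_all_iff.mpr fun ξ =>
    ae_tendsto_avN_of_koopman_eq_smul hT hμ (hv ξ) (hv1 ξ)] with x hx hlim
  -- Genericity alone handles the uncountably many non-eigenvalues, with no further exceptional set.
  have hlim0 := fun ξ (hξ : ξ ∉ Spec hμ) => hx.tendsto_avN_of_notMem_Spec hc hμ hξ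
  have hww : IsWWGeneric T μ x := ⟨hx, fun f ξ => by
    by_cases hξ : ξ ∈ Spec hμ
    · exact ⟨_, (hlim ⟨ξ, hξ⟩).2 f⟩
    · exact ⟨0, hlim0 ξ hξ f⟩⟩
  have hav0 : ∀ f : C(X, ℂ), ∀ ξ ∉ Spec hμ, av T f ξ x = 0 := fun f ξ hξ =>
    tendsto_nhds_unique (hww.2 f ξ).tendsto (hlim0 ξ hξ f)
  have hall : ∀ f : C(X, ℂ), HasSum (fun ξ : Circle => ‖av T f ξ x‖ ^ 2)
      (kroneckerNormSq hμ f) := fun f => by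
    refine (hasSum_subtype_iff_of_support_subset (s := Spec hμ) fun ξ h => ?_).mp ?_
    · by_contra hn
      exact h (by simp [hav0 f ξ hn])
    · convert! hsum f using 2 with ξ
      have h1 : av T f ξ x = v ξ x * ⟪v ξ, ContinuousMap.toLp 2 μ ℂ f⟫_ℂ :=
        tendsto_nhds_unique (hww.2 f ξ).tendsto ((hlim ξ).2 f)
      rw [Function.comp_apply, h1, norm_mul, (hlim ξ).1, one_mul]
  refine ⟨⟨hww, fun f => ?_⟩, fun f => ?_⟩
  · refine (hasSum_subtype_iff_of_support_subset fun ξ h => ?_).mpr (hall f)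
    by_contra hn
    exact h (by simp [av_eq_zero_of_notMem_Freq hww hn f])
  · refine (hasSum_subtype_iff_of_support_subset fun ξ h => ?_).mpr (hall f)
    by_contra hn
    exact h (by simp [hav0 f ξ fun h => hn (hΞ h)])

end WienerWintner

/-! ### The equivalence -/

theorem mainTheorem5 {X : Type*} [MetricSpace X] [CompactSpace X] [MeasurableSpace X]
    [BorelSpace X] (T : X → X) (hT : Continuous T)
    (μ : Measure X) [IsProbabilityMeasure μ] (hμ : MeasurePreserving T μ μ)
    (Ξ : Set Circle) :
    List.TFAE
      [ Ergodic T μ ∧ WienerWintner.Spec hμ ⊆ Ξ,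
        ∃ X' : Set X, MeasurableSet X' ∧ μ X' = 1 ∧
          ∀ x ∈ X', WienerWintner.IsRegularWWGeneric hμ x ∧
            ∀ f : C(X, ℂ), HasSum (fun ξ : Ξ => ‖WienerWintner.av T f ξ x‖ ^ 2)
              (WienerWintner.kroneckerNormSq hμ f),
        ∃ x : X, WienerWintner.IsGeneric T μ x ∧
          ∃ D : Set C(X, ℂ), D.Countable ∧ Dense D ∧
            ∀ f ∈ D, (∀ ξ ∈ Ξ, WienerWintner.AvConverges T f ξ x) ∧
              HasSum (fun ξ : Ξ => ‖WienerWintner.av T f ξ x‖ ^ 2)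
                (WienerWintner.kroneckerNormSq hμ f),
        ∃ x : X, WienerWintner.IsRegularWWGeneric hμ x ∧ WienerWintner.Freq T x ⊆ Ξ ] := by
  tfae_have 1 → 2 := by
    rintro ⟨hE, hΞ⟩
    obtain ⟨X', hsub, hm, hnull⟩ := exists_measurable_superset_of_null
      (ae_iff.mp (WienerWintner.ae_isRegularWWGeneric hT hE hμ hΞ))
    refine ⟨X'ᶜ, hm.compl, (prob_compl_eq_one_iff hm).mpr hnull, fun x hx => ?_⟩
    by_contra hn
    exact hx (hsub hn)
  tfae_have 2 → 4 := by
    rintro ⟨X', -, h1, h⟩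
    obtain ⟨x, hx⟩ := nonempty_of_measure_ne_zero (h1 ▸ one_ne_zero : μ X' ≠ 0)
    exact ⟨x, (h x hx).1, (h x hx).1.Freq_subset_of_hasSum (h x hx).2⟩
  tfae_have 4 → 3 := by
    rintro ⟨x, hx, hΞ⟩
    obtain ⟨D, hDc, hD⟩ := TopologicalSpace.exists_countable_dense C(X, ℂ)
    exact ⟨x, hx.1.1, D, hDc, hD, fun f _ =>
      ⟨fun ξ _ => hx.1.2 f ξ, hx.hasSum_of_Freq_subset hΞ f⟩⟩
  tfae_have 3 → 1 := by
    rintro ⟨x, hx, D, -, hD, h⟩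
    exact WienerWintner.ergodic_and_Spec_subset hT hμ hx hD h
  tfae_finish
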